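/- Let $C$ be a set of colours. A hypergraph is a pair $H=(V,E)$ with $V=V(H)$ a finite set of vertices and $E=E(H)$ a finite set of edges, each edge being an ordered tuple $(v_1,\dots,v_r;c)$ of $r\ge 2$ distinct vertices together with a colour $c\in C$. Isomorphisms preserve the direction and the colour of the edges. The null hypergraph (no vertices) is allowed, and $K_1$ is the hypergraph with one vertex. For $U\subseteq V(H)$, the induced subhypergraph $H[U]$ has vertex set $U$ and all edges of $H$ whose vertices all lie in $U$; an induced subhypergraph of $H$ is any hypergraph isomorphic to some $H[U]$. A hypergraph property is an isomorphism-closed class of hypergraphs that contains a hypergraph with at least one vertex. It is additive if it is closed under disjoint union, and induced-hereditary if it is closed under taking induced subhypergraphs. For properties $\mathcal P_1,\mathcal P_2$, $\mathcal P_1\circ\mathcal P_2$ is the class of hypergraphs $H$ whose vertex set has a partition $(V_1,V_2)$, with parts possibly empty, such that $H[V_i]\in\mathcal P_i$ for $i=1,2$. An additive induced-hereditary property $\mathcal P$ is reducible if $\mathcal P=\mathcal P_1\circ\mathcal P_2$ for some additive induced-hereditary properties $\mathcal P_1,\mathcal P_2$; otherwise it is irreducible. For hypergraphs $G_1,\dots,G_n$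 with pairwise disjoint vertex sets, $G_1*\cdots*G_n$ is the set of all hypergraphs $H$ with $V(H)=\bigcup_i V(G_i)$ and $H[V(G_i)]=G_i$ for all $i$; $kG$ is the disjoint union of $k$ copies of $G$. A $\mathcal P$-decomposition of $G$ with $n$ parts is a partition $(V_1,\dots,V_n)$ of $V(G)$ into non-empty sets such that $kG[V_1]*\cdots*kG[V_n]\subseteq\mathcal P$ for all integers $k\ge 1$. If $G\in\mathcal P$, then $dec_{\mathcal P}(G)$ is the maximum number of parts in a $\mathcal P$-decomposition of $G$; if $G\notin\mathcal P$, then $dec_{\mathcal P}(G)=0$. A hypergraph $G$ is $\mathcal P$-strict if $G\in\mathcal P$ but $G*K_1\not\subseteq\mathcal P$. Let $dec(\mathcal P)$ be the minimum of $dec_{\mathcal P}(G)$ over all $\mathcal P$-strict hypergraphs $G$, with $dec(\mathcal P)=\infty$ if there is none (that is, if $\mathcal P$ contains every hypergraph). The property $\mathcal P$ is indecomposable if $dec(\mathcal P)=1$. Corollary. Let $\mathcal P$ be an additive induced-hereditary hypergraph property. Then $\mathcal P$ is irreducible if and only if it is indecomposable. -/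

import Mathlib

/-- A finite hypergraph with directed edges coloured from `C`. An edge is an ordered tuple
`(v₁, …, vᵣ; c)` of `r ≥ 2` distinct vertices (no loops) with a colour `c`; since the edges form
a set, no edge is repeated. The null hypergraph (no vertices) is allowed. -/
structure DCHypergraph (C : Type*) where
  /-- the vertices -/
  V : Type
  finite_V : Finite V
  /-- the edges -/
  E : Set (List V × C)
  finite_E : E.Finite
  nodup : ∀ e ∈ E, e.1.Nodup
  two_le_length : ∀ e ∈ E, 2 ≤ e.1.length

namespace DCHypergraph

variable {C : Type*}

/-- Isomorphisms: bijections of the vertices that preserve and reflect the edges, with their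
colour and their direction. -/
structure Iso (G H : DCHypergraph C) where
  toEquiv : G.V ≃ H.V
  mem_iff : ∀ (l : List G.V) (c : C), (l, c) ∈ G.E ↔ (l.map toEquiv, c) ∈ H.E

/-- The subhypergraph `G[U]` induced by `U`: its edges are the edges of `G` all of whose vertices
lie in `U`. -/
def induce (G : DCHypergraph C) (U : Set G.V) : DCHypergraph C where
  V := U
  finite_V := haveI := G.finite_V; inferInstance
  E := {e | (e.1.map Subtype.val, e.2) ∈ G.E}
  finite_E := by
    refine G.finite_E.preimage (f := fun e : List U × C => (e.1.map Subtype.val, e.2)) ?_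
    rintro ⟨l, c⟩ - ⟨l', c'⟩ - h
    simp only [Prod.mk.injEq] at h ⊢
    exact ⟨List.map_injective_iff.2 Subtype.val_injective h.1, h.2⟩
  nodup := fun e he => List.Nodup.of_map _ (G.nodup _ he)
  two_le_length := fun e he => by simpa using G.two_le_length _ he

/-- `K ≤ H`: `K` is isomorphic to an induced subhypergraph of `H`. -/
def IsInducedSub (K H : DCHypergraph C) : Prop :=
  ∃ U : Set H.V, Nonempty (Iso K (H.induce U))

/-- The disjoint union of a finite family of hypergraphs. -/
def disjointUnion {ι : Type} [Finite ι] (G : ι → DCHypergraph C) : DCHypergraph C where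
  V := Σ i, (G i).V
  finite_V := haveI := fun i => (G i).finite_V; inferInstance
  E := ⋃ i, (fun e : List (G i).V × C =>
    ((e.1.map (Sigma.mk i), e.2) : List (Σ j, (G j).V) × C)) '' (G i).E
  finite_E := Set.finite_iUnion fun i => (G i).finite_E.image _
  nodup := by
    intro e he
    obtain ⟨i, e', he', rfl⟩ := Set.mem_iUnion.1 he
    exact ((G i).nodup _ he').map sigma_mk_injective
  two_le_length := by
    intro e he
    obtain ⟨i, e', he', rfl⟩ := Set.mem_iUnion.1 he
    simpa using (G i).two_le_length _ he'

/-- `kG`, the disjoint union of `k` copies of `G`. -/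
def copies (k : ℕ) (G : DCHypergraph C) : DCHypergraph C :=
  disjointUnion fun _ : Fin k => G

/-- `K₁`, the hypergraph with one vertex. -/
def single : DCHypergraph C where
  V := Unit
  finite_V := inferInstance
  E := ∅
  finite_E := Set.finite_empty
  nodup := by simp
  two_le_length := by simp

/-- The `*`-join `G₁ * ⋯ * Gₙ`: the hypergraphs `H` (up to isomorphism) whose vertex set is the
disjoint union of the `V(Gᵢ)`, such that `H[V(Gᵢ)] = Gᵢ` for every `i`. Edges that meet two or more
of the `V(Gᵢ)` are arbitrary. -/
def starJoin {n : ℕ} (G : Fin n → DCHypergraph C) : Set (DCHypergraph C) :=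
  {H | ∃ φ : (Σ i, (G i).V) ≃ H.V, ∀ (i : Fin n) (l : List (G i).V) (c : C),
    (l.map (fun v => φ ⟨i, v⟩), c) ∈ H.E ↔ (l, c) ∈ (G i).E}

/-- A hypergraph property: a class of hypergraphs that is closed under isomorphism and non-empty,
in the sense that it has a member other than the null hypergraph. -/
structure IsProperty (P : Set (DCHypergraph C)) : Prop where
  iso_closed : ∀ G H : DCHypergraph C, Nonempty (Iso G H) → G ∈ P → H ∈ P
  exists_nonnull : ∃ G ∈ P, Nonempty G.V

/-- `P` is closed under induced subhypergraphs. -/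
def IsInducedHereditary (P : Set (DCHypergraph C)) : Prop :=
  ∀ K H : DCHypergraph C, H ∈ P → IsInducedSub K H → K ∈ P

/-- `P` is closed under disjoint unions. -/
def IsAdditive (P : Set (DCHypergraph C)) : Prop :=
  ∀ G H : DCHypergraph C, G ∈ P → H ∈ P → disjointUnion ![G, H] ∈ P

/-- Additive induced-hereditary hypergraph properties. -/
structure IsAdditiveInducedHereditary (P : Set (DCHypergraph C)) : Prop where
  isProperty : IsProperty P
  isInducedHereditary : IsInducedHereditary P
  isAdditive : IsAdditive P

/-- `(W 0, …, W (n-1))` is a partition of the vertex set of `G`; parts may be empty. -/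
def IsPartition (G : DCHypergraph C) {n : ℕ} (W : Fin n → Set G.V) : Prop :=
  (∀ i j, i ≠ j → Disjoint (W i) (W j)) ∧ ⋃ i, W i = Set.univ

/-- The product `P₁ ∘ ⋯ ∘ Pₙ`: the hypergraphs that have a `(P₁, …, Pₙ)`-partition. -/
def product {n : ℕ} (P : Fin n → Set (DCHypergraph C)) : Set (DCHypergraph C) :=
  {G | ∃ W : Fin n → Set G.V, IsPartition G W ∧ ∀ i, G.induce (W i) ∈ P i}

/-- `P` is the product of two additive induced-hereditary properties. -/
def IsReducible (P : Set (DCHypergraph C)) : Prop :=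
  ∃ P₁ P₂ : Set (DCHypergraph C), IsAdditiveInducedHereditary P₁ ∧
    IsAdditiveInducedHereditary P₂ ∧ P = product ![P₁, P₂]

/-- Irreducible: not reducible. -/
def IsIrreducible (P : Set (DCHypergraph C)) : Prop := ¬ IsReducible P

/-- A `P`-decomposition of `G` with `n` parts. -/
def IsDecomposition (P : Set (DCHypergraph C)) (G : DCHypergraph C) {n : ℕ}
    (W : Fin n → Set G.V) : Prop :=
  IsPartition G W ∧ (∀ i, (W i).Nonempty) ∧
    ∀ k : ℕ, 1 ≤ k → starJoin (fun i => copies k (G.induce (W i))) ⊆ P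

/-- `dec_P(G)`: the maximum number of parts in a `P`-decomposition of `G`, and `0` if `G ∉ P`. -/
noncomputable def decNumber (P : Set (DCHypergraph C)) (G : DCHypergraph C) : ℕ∞ :=
  sSup {m : ℕ∞ | ∃ n : ℕ, m = n ∧ G ∈ P ∧ ∃ W : Fin n → Set G.V, IsDecomposition P G W}

/-- `S(P)`, the set of `P`-strict hypergraphs: `G ∈ P` but `G * K₁ ⊄ P`. -/
def strict (P : Set (DCHypergraph C)) : Set (DCHypergraph C) :=
  {G | G ∈ P ∧ ¬ starJoin ![G, single] ⊆ P}

/-- `dec(P)`, the minimum of `dec_P(G)` over the `P`-strict `G`. It is `⊤` if there is no `P`-strict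
hypergraph, which for an induced-hereditary `P` means that `P` contains every hypergraph. -/
noncomputable def dec (P : Set (DCHypergraph C)) : ℕ∞ := ⨅ G ∈ strict P, decNumber P G

/-- Indecomposable: `dec(P) = 1`. -/
def IsIndecomposable (P : Set (DCHypergraph C)) : Prop := dec P = 1

end DCHypergraph

/-! If `P` is the product of `P₁` and `P₂`, a `(P₁, P₂)`-partition of a `P`-strict `G` has no empty
part, since an empty part could absorb an added vertex and every one-vertex extension of `G` would
lie in `P`. By additivity of the factors this partition is a decomposition, so `dec P ≥ 2`
(`IsReducible.two_le_dec`).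

Conversely, suppose every strict hypergraph has a decomposition with at least two parts. The factors
come from a 2-colouring of the infinite disjoint union of all members of `P`. A strict `G₀` is
fixed. For a finite set of members containing `G₀`, the disjoint union is strict; one part of a
decomposition is coloured true, the rest false. This colouring is compatible with `P`: edges meeting
both colours may be chosen freely. Strictness of `G₀` forces both colours to occur on `G₀` itself
(`IsCompatible.exists_color`), so neither colour is lost in the ultrafilter limit over all finite
sets (`exists_isCompatible_univ`). In the limit, the hypergraphs embedding into copies of one colour
form an additive induced-hereditary property, and compatibility says exactly that the product of the
two such properties is contained in `P` (`IsCompatible.eq_product`). If nothing is strict, `P`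
contains everything and is its own square. -/

namespace DCHypergraph

/-! ### Embeddings, disjoint unions and countable copies -/

/-- `f` embeds the structure with edge set `E` as an induced substructure of that with edge set
`E'`. -/
def IsEmb {C α β : Type*} (E : Set (List α × C)) (E' : Set (List β × C)) (f : α → β) : Prop :=
  Function.Injective f ∧ ∀ l c, (l, c) ∈ E ↔ (l.map f, c) ∈ E'

/-- The edge set of countably many disjoint copies of the structure with edge set `E`. -/
def copyEdges {C α : Type*} (E : Set (List α × C)) : Set (List (ℕ × α) × C) :=
  {e | ∃ a l, (l, e.2) ∈ E ∧ l.map (Prod.mk a) = e.1}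

theorem IsEmb.comp {C α β γ : Type*} {E : Set (List α × C)} {E' : Set (List β × C)}
    {E'' : Set (List γ × C)} {g : β → γ} {f : α → β} (hg : IsEmb E' E'' g) (hf : IsEmb E E' f) :
    IsEmb E E'' (g ∘ f) :=
  ⟨hg.1.comp hf.1, fun l c => by rw [hf.2, hg.2, List.map_map]⟩

theorem exists_map_eq_of_forall_mem {α β : Type*} (f : α → β) (l : List β)
    (h : ∀ x ∈ l, ∃ y, f y = x) : ∃ l' : List α, l'.map f = l := by
  have : l ∈ Set.range (List.map f) := by
    rw [Set.range_list_map]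
    exact h
  exact this

variable {C : Type*}

theorem Iso.isEmb {G H : DCHypergraph C} (e : Iso G H) : IsEmb G.E H.E e.toEquiv :=
  ⟨e.toEquiv.injective, e.mem_iff⟩

/-- The inclusion of the vertices of an induced subhypergraph. -/
def inducedVal (H : DCHypergraph C) (U : Set H.V) : (H.induce U).V → H.V := Subtype.val

theorem isEmb_inducedVal (H : DCHypergraph C) (U : Set H.V) :
    IsEmb (H.induce U).E H.E (H.inducedVal U) :=
  ⟨Subtype.val_injective, fun _ _ => Iff.rfl⟩

theorem inducedVal_mem (H : DCHypergraph C) (U : Set H.V) (v : (H.induce U).V) :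
    H.inducedVal U v ∈ U := v.2

theorem exists_inducedVal (H : DCHypergraph C) {U : Set H.V} {v : H.V} (hv : v ∈ U) :
    ∃ w, H.inducedVal U w = v := ⟨⟨v, hv⟩, rfl⟩

/-- The inclusion of a component of a disjoint union. -/
def incl {ι : Type} [Finite ι] (X : ι → DCHypergraph C) (i : ι) :
    (X i).V → (disjointUnion X).V := fun v => (⟨i, v⟩ : Σ j, (X j).V)

/-- The map on a disjoint union given by maps on the components. -/
def glue {ι : Type} [Finite ι] {X : ι → DCHypergraph C} {β : Type*} (f : ∀ i, (X i).V → β) :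
    (disjointUnion X).V → β := fun x => f x.1 x.2

@[simp] theorem glue_incl {ι : Type} [Finite ι] {X : ι → DCHypergraph C} {β : Type*}
    (f : ∀ i, (X i).V → β) (i : ι) (v : (X i).V) : glue f (incl X i v) = f i v := rfl

theorem glue_comp_incl {ι : Type} [Finite ι] {X : ι → DCHypergraph C} {β : Type*}
    (f : ∀ i, (X i).V → β) (i : ι) : glue f ∘ incl X i = f i := rfl

theorem exists_incl {ι : Type} [Finite ι] {X : ι → DCHypergraph C} (x : (disjointUnion X).V) :
    ∃ i v, incl X i v = x := ⟨x.1, x.2, rfl⟩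

theorem incl_injective {ι : Type} [Finite ι] (X : ι → DCHypergraph C) (i : ι) :
    Function.Injective (incl X i) := fun _ _ h => eq_of_heq (Sigma.mk.inj h).2

theorem incl_index {ι : Type} [Finite ι] {X : ι → DCHypergraph C} {i j : ι} {v : (X i).V}
    {w : (X j).V} (h : incl X i v = incl X j w) : i = j := congrArg Sigma.fst h

theorem exists_map_incl {ι : Type} [Finite ι] {X : ι → DCHypergraph C}
    {l : List (disjointUnion X).V} {i : ι} (h : ∀ j v, incl X j v ∈ l → j = i) :
    ∃ l' : List (X i).V, l'.map (incl X i) = l := by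
  refine exists_map_eq_of_forall_mem _ _ fun x hx => ?_
  obtain ⟨j, v, rfl⟩ := exists_incl x
  obtain rfl := h j v hx
  exact ⟨v, rfl⟩

theorem IsEmb.isInducedSub {K H : DCHypergraph C} {f : K.V → H.V} (hf : IsEmb K.E H.E f) :
    IsInducedSub K H :=
  ⟨Set.range f, ⟨⟨Equiv.ofInjective f hf.1, fun l c => by
    rw [hf.2]
    have : (l.map (Equiv.ofInjective f hf.1)).map Subtype.val = l.map f := by
      rw [List.map_map]
      rfl
    exact iff_of_eq (congrArg (fun l => (l, c) ∈ H.E) this.symm)⟩⟩⟩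

theorem IsInducedSub.exists_isEmb {K H : DCHypergraph C} (h : IsInducedSub K H) :
    ∃ f : K.V → H.V, IsEmb K.E H.E f := by
  obtain ⟨U, ⟨e⟩⟩ := h
  exact ⟨_, (isEmb_inducedVal H U).comp e.isEmb⟩

theorem isInducedHereditary_iff {P : Set (DCHypergraph C)} :
    IsInducedHereditary P ↔
      ∀ (K H : DCHypergraph C) (f : K.V → H.V), IsEmb K.E H.E f → H ∈ P → K ∈ P :=
  ⟨fun h K H _ hf hH => h K H hH hf.isInducedSub, fun h K H hH hK =>
    let ⟨f, hf⟩ := hK.exists_isEmb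
    h K H f hf hH⟩

theorem IsInducedHereditary.mem_of_isEmb {P : Set (DCHypergraph C)} (h : IsInducedHereditary P)
    {K H : DCHypergraph C} {f : K.V → H.V} (hf : IsEmb K.E H.E f) (hH : H ∈ P) : K ∈ P :=
  isInducedHereditary_iff.1 h K H f hf hH

theorem not_mem_of_subsingleton {H : DCHypergraph C} {l : List H.V} {c : C} {x : H.V}
    (h : ∀ v ∈ l, v = x) : (l, c) ∉ H.E := by
  intro hl
  have h1 := H.nodup _ hl
  have h2 := H.two_le_length _ hl
  rw [List.eq_replicate_of_mem h, List.nodup_replicate] at h1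
  simp only at h2
  omega

theorem nil_not_mem (H : DCHypergraph C) (c : C) : ([], c) ∉ H.E := fun h => by
  simpa using H.two_le_length _ h

theorem mem_of_isEmpty {P : Set (DCHypergraph C)} (h : IsAdditiveInducedHereditary P)
    (K : DCHypergraph C) [IsEmpty K.V] : K ∈ P := by
  obtain ⟨G, hG, -⟩ := h.isProperty.exists_nonnull
  refine h.isInducedHereditary.mem_of_isEmb (f := isEmptyElim)
    ⟨fun x => isEmptyElim x, fun l c => ?_⟩ hG
  have : l = [] := List.eq_nil_iff_forall_not_mem.2 fun x => isEmptyElim x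
  subst this
  simp [nil_not_mem]

theorem mem_of_subsingleton {P : Set (DCHypergraph C)} (h : IsAdditiveInducedHereditary P)
    (K : DCHypergraph C) (x : K.V) (hx : ∀ v, v = x) : K ∈ P := by
  obtain ⟨G, hG, ⟨y⟩⟩ := h.isProperty.exists_nonnull
  refine h.isInducedHereditary.mem_of_isEmb (f := fun _ => y)
    ⟨fun v w _ => (hx v).trans (hx w).symm, fun l c => ?_⟩ hG
  exact iff_of_false (not_mem_of_subsingleton (x := x) fun v _ => hx v)
    (not_mem_of_subsingleton (x := y) (by simp))

theorem mem_disjointUnion_E {ι : Type} [Finite ι] {X : ι → DCHypergraph C}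
    {l : List (disjointUnion X).V} {c : C} :
    (l, c) ∈ (disjointUnion X).E ↔ ∃ i l', (l', c) ∈ (X i).E ∧ l'.map (incl X i) = l := by
  refine Set.mem_iUnion.trans (exists_congr fun i => ?_)
  constructor
  · rintro ⟨⟨l', c'⟩, h, e⟩
    obtain ⟨rfl, rfl⟩ := Prod.mk.inj e
    exact ⟨l', h, rfl⟩
  · rintro ⟨l', h, rfl⟩
    exact ⟨(l', c), h, rfl⟩

theorem map_incl_mem {ι : Type} [Finite ι] {X : ι → DCHypergraph C} {i : ι}
    {l : List (X i).V} {c : C} :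
    (l.map (incl X i), c) ∈ (disjointUnion X).E ↔ (l, c) ∈ (X i).E := by
  rw [mem_disjointUnion_E]
  constructor
  · rintro ⟨j, l', h, e⟩
    cases l' with
    | nil => exact absurd h (nil_not_mem _ _)
    | cons v l' =>
      cases l with
      | nil => simp at e
      | cons w l =>
        obtain rfl : j = i := by
          simp only [List.map_cons, List.cons.injEq] at e
          exact incl_index e.1
        rwa [← List.map_injective_iff.2 (incl_injective X j) e]
  · exact fun h => ⟨i, l, h, rfl⟩

/-- The components receive distinct copy numbers, so their images in `E` are allowed to overlap. -/
theorem isEmb_disjointUnion {β : Type*} {E : Set (List β × C)} (hE : ∀ c, ([], c) ∉ E)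
    {ι : Type} [Finite ι] (X : ι → DCHypergraph C) {num : ι → ℕ} (hnum : Function.Injective num)
    {f : ∀ i, (X i).V → β} (hf : ∀ i, IsEmb (X i).E E (f i)) :
    IsEmb (disjointUnion X).E (copyEdges E) (glue fun i v => (num i, f i v)) := by
  constructor
  · intro x y h
    obtain ⟨i, v, rfl⟩ := exists_incl x
    obtain ⟨j, w, rfl⟩ := exists_incl y
    have h' : (num i, f i v) = (num j, f j w) := h
    obtain ⟨h1, h2⟩ := Prod.mk.inj h'
    obtain rfl := hnum h1
    exact congrArg _ ((hf _).1 h2)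
  · intro l c
    constructor
    · intro h
      obtain ⟨i, l', h', rfl⟩ := mem_disjointUnion_E.1 h
      refine ⟨num i, l'.map (f i), ((hf i).2 _ _).1 h', ?_⟩
      rw [List.map_map, List.map_map]
      rfl
    · rintro ⟨a, l', h, e⟩
      simp only at h e
      have key : ∀ i v, incl X i v ∈ l → num i = a := by
        intro i v hx
        have : (num i, f i v) ∈ l'.map (Prod.mk a) := by
          rw [e]
          exact List.mem_map_of_mem (f := glue fun i v => (num i, f i v)) hx
        obtain ⟨_, _, h⟩ := List.mem_map.1 this
        exact (congrArg Prod.fst h).symm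
      cases l with
      | nil =>
        obtain rfl : l' = [] := by simpa using e
        exact absurd h (hE c)
      | cons x l =>
        obtain ⟨i, v, rfl⟩ := exists_incl x
        obtain ⟨l₁, hl₁⟩ := exists_map_incl (l := incl X i v :: l) (i := i) fun j w hw =>
          hnum ((key j w hw).trans (key i v (by simp)).symm)
        rw [← hl₁] at e ⊢
        refine map_incl_mem.2 (((hf _).2 _ _).2 ?_)
        have := congrArg (List.map Prod.snd) e
        simp only [List.map_map, glue_comp_incl] at this
        convert h using 2
        simpa [Function.comp_def] using this.symm

/-- The pairing function merges the two copy numbers into one. This is what makes the colour classes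
additive. -/
theorem isEmb_copyEdges_copyEdges {β : Type*} (E : Set (List β × C)) :
    IsEmb (copyEdges (copyEdges E)) (copyEdges E) (fun x => (Nat.pair x.1 x.2.1, x.2.2)) := by
  constructor
  · rintro ⟨a, b, v⟩ ⟨a', b', v'⟩ h
    simp only [Prod.mk.injEq, Nat.pair_eq_pair] at h
    simp [h]
  · intro l c
    constructor
    · rintro ⟨a, _, ⟨b, l', h, rfl⟩, e⟩
      simp only at e h
      exact ⟨Nat.pair a b, l', h, by simp [← e]⟩
    · rintro ⟨n, l', h, e⟩
      simp only at h e
      refine ⟨n.unpair.1, l'.map (Prod.mk n.unpair.2), ⟨_, _, h, rfl⟩, ?_⟩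
      have := congrArg (List.map fun x : ℕ × β => (x.1.unpair.1, (x.1.unpair.2, x.2))) e
      simpa [Function.comp_def] using this

theorem disjointUnion_mem {P : Set (DCHypergraph C)} (h : IsAdditiveInducedHereditary P) :
    ∀ {n : ℕ} (X : Fin n → DCHypergraph C), (∀ i, X i ∈ P) → disjointUnion X ∈ P
  | 0, X, _ =>
    haveI : IsEmpty (disjointUnion X).V := ⟨fun x => x.1.elim0⟩
    mem_of_isEmpty h _
  | n + 1, X, hX => by
    have ih := disjointUnion_mem h (fun i : Fin n => X i.succ) fun i => hX _
    have h2 := h.isAdditive _ _ (hX 0) ih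
    let Z : Fin n → DCHypergraph C := fun i => X i.succ
    let Y : Fin 2 → DCHypergraph C := ![X 0, disjointUnion Z]
    let g : ∀ i : Fin (n + 1), (X i).V → (disjointUnion Y).V :=
      Fin.cases (incl Y 0) (fun i => incl Y 1 ∘ incl Z i)
    have hg : ∀ i l c, (l, c) ∈ (X i).E ↔ (l.map (g i), c) ∈ (disjointUnion Y).E := by
      intro i l c
      induction i using Fin.cases with
      | zero => exact (map_incl_mem (X := Y) (i := 0)).symm
      | succ i =>
        refine (map_incl_mem (X := Z)).symm.trans
          ((map_incl_mem (X := Y) (i := 1)).symm.trans (iff_of_eq ?_))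
        exact congrArg (fun l => (l, c) ∈ (disjointUnion Y).E) (List.map_map (l := l))
    -- `π` recovers the component of `X` from a vertex of the nested union.
    let π : (disjointUnion Y).V → Fin (n + 1) :=
      glue (Fin.cons (α := fun i => (Y i).V → Fin (n + 1)) (fun _ => 0)
        (Fin.cons (glue (X := Z) fun i _ => i.succ) finZeroElim))
    have hπ : ∀ i v, π (g i v) = i := by
      intro i v
      induction i using Fin.cases with
      | zero => rfl
      | succ i => rfl
    have hinj : ∀ i, Function.Injective (g i) := by
      intro i
      induction i using Fin.cases with
      | zero => exact incl_injective Y 0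
      | succ i => exact (incl_injective Y 1).comp (incl_injective Z i)
    refine h.isInducedHereditary.mem_of_isEmb (f := glue g) ⟨?_, ?_⟩ h2
    · intro x y e
      obtain ⟨i, v, rfl⟩ := exists_incl x
      obtain ⟨j, w, rfl⟩ := exists_incl y
      obtain rfl : i = j := by
        have := congrArg π e
        simpa only [glue_incl, hπ] using this
      exact congrArg _ (hinj _ e)
    · intro l c
      constructor
      · intro hl
        obtain ⟨i, l', hl', rfl⟩ := mem_disjointUnion_E.1 hl
        rw [List.map_map]
        exact (hg i _ _).1 hl'
      · intro hl
        have key : ∃ i, ∀ j v, incl X j v ∈ l → j = i := by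
          obtain ⟨j, l', hl', e⟩ := mem_disjointUnion_E.1 hl
          have hmem : ∀ i v, incl X i v ∈ l → ∃ y ∈ l', incl Y j y = g i v := by
            intro i v hx
            have : g i v ∈ l'.map (incl Y j) := by
              rw [e]
              exact List.mem_map_of_mem (f := glue g) hx
            exact List.mem_map.1 this
          induction j using Fin.cases with
          | zero =>
            refine ⟨0, fun i v hx => ?_⟩
            obtain ⟨y, _, e⟩ := hmem i v hx
            rw [← hπ i v, ← e]
            rfl
          | succ j =>
            obtain rfl := Subsingleton.elim j 0
            obtain ⟨i, l'', hl'', rfl⟩ := (mem_disjointUnion_E (X := Z)).1 hl'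
            refine ⟨i.succ, fun i' v hx => ?_⟩
            obtain ⟨y, hy, e⟩ := hmem i' v hx
            obtain ⟨z, _, rfl⟩ := List.mem_map.1 hy
            rw [← hπ i' v, ← e]
            rfl
        obtain ⟨i, hi⟩ := key
        obtain ⟨l', rfl⟩ := exists_map_incl hi
        rw [List.map_map] at hl
        exact map_incl_mem.2 ((hg i _ _).2 hl)

/-! ### Amalgamation, vertex extensions and strictness -/

/-- Amalgamation: `H` embeds in a member of `X₁ * ⋯ * Xₙ` as soon as a map to the disjoint union of
the vertex sets is compatible with the edges inside each `Xᵢ`. -/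
theorem mem_of_starJoin_subset {P : Set (DCHypergraph C)} (h : IsInducedHereditary P) {n : ℕ}
    {X : Fin n → DCHypergraph C} (hX : starJoin X ⊆ P) {H : DCHypergraph C}
    {f : H.V → (disjointUnion X).V} (hf : Function.Injective f)
    (hloc : ∀ i l (l' : List (X i).V) c, l'.map (incl X i) = l.map f →
      ((l, c) ∈ H.E ↔ (l', c) ∈ (X i).E)) : H ∈ P := by
  let D := disjointUnion X
  -- The disjoint union enlarged by the edges of `H`. By `hloc` these add nothing inside any `X i`,
  -- and the old edges add nothing to the image of `H`.
  let H' : DCHypergraph C :=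
    { V := D.V
      finite_V := D.finite_V
      E := D.E ∪ (fun e : List H.V × C => (e.1.map f, e.2)) '' H.E
      finite_E := D.finite_E.union (H.finite_E.image _)
      nodup := by
        rintro e (he | ⟨e, he, rfl⟩)
        · exact D.nodup _ he
        · exact (H.nodup _ he).map hf
      two_le_length := by
        rintro e (he | ⟨e, he, rfl⟩)
        · exact D.two_le_length _ he
        · simpa using H.two_le_length _ he }
  refine h.mem_of_isEmb (H := H') (f := f) ⟨hf, fun l c => ?_⟩
    (hX ⟨Equiv.refl _, fun i l c => ?_⟩)
  · constructor
    · exact fun hl => Or.inr ⟨_, hl, rfl⟩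
    · rintro (hl | ⟨⟨l', c'⟩, hl, e⟩)
      · obtain ⟨i, l', hl', e⟩ := mem_disjointUnion_E.1 hl
        exact (hloc i l l' c e).2 hl'
      · obtain ⟨e1, rfl⟩ := Prod.mk.inj e
        rwa [← List.map_injective_iff.2 hf e1]
  · constructor
    · rintro (hl | ⟨⟨l', c'⟩, hl, e⟩)
      · exact map_incl_mem.1 hl
      · obtain ⟨e1, rfl⟩ := Prod.mk.inj e
        exact (hloc i l' l c' e1.symm).1 hl
    · exact fun hl => Or.inl (map_incl_mem.2 hl)

theorem IsEmb.exists_lift {α β γ : Type*} {E : Set (List α × C)} {E' : Set (List β × C)}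
    {E'' : Set (List γ × C)} {g : β → γ} {k : α → γ} (hg : IsEmb E' E'' g) (hk : IsEmb E E'' k)
    (h : ∀ x, ∃ y, g y = k x) : ∃ f : α → β, IsEmb E E' f := by
  choose f hf using h
  refine ⟨f, fun x y e => hk.1 (by rw [← hf, ← hf, e]), fun l c => ?_⟩
  rw [hk.2, hg.2, List.map_map]
  have : g ∘ f = k := funext hf
  rw [this]

theorem isEmb_of_starJoin {n : ℕ} {X : Fin n → DCHypergraph C} {H : DCHypergraph C}
    {φ : (Σ i, (X i).V) ≃ H.V} (hφ : ∀ (i : Fin n) (l : List (X i).V) (c : C),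
      (l.map (fun v => φ ⟨i, v⟩), c) ∈ H.E ↔ (l, c) ∈ (X i).E) (i : Fin n) :
    IsEmb (X i).E H.E (fun v => φ ⟨i, v⟩) :=
  ⟨φ.injective.comp (sigma_mk_injective (β := fun i => (X i).V)), fun l c => (hφ i l c).symm⟩

theorem isEmb_copyEdges {β : Type*} (E : Set (List β × C)) (n : ℕ) :
    IsEmb E (copyEdges E) (Prod.mk n) := by
  refine ⟨fun a b h => (Prod.mk.inj h).2, fun l c => ⟨fun h => ⟨n, l, h, rfl⟩, ?_⟩⟩
  rintro ⟨m, l', h, e⟩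
  have := congrArg (List.map Prod.snd) e
  simp only [List.map_map, Function.comp_def, List.map_id'] at this
  subst this
  exact h

theorem not_mem_copyEdges {β : Type*} {E : Set (List β × C)} (hE : ∀ c, ([], c) ∉ E) (c : C) :
    ([], c) ∉ copyEdges E := by
  rintro ⟨a, l, h, e⟩
  obtain rfl : l = [] := by simpa using e
  exact hE c h

/-- `H` is obtained from an induced subhypergraph of `G` by adding a vertex. -/
def IsVertexExtension (G H : DCHypergraph C) : Prop :=
  ∃ (x : H.V) (f : (H.induce {x}ᶜ).V → G.V), IsEmb (H.induce {x}ᶜ).E G.E f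

theorem IsVertexExtension.of_isEmb {G F H : DCHypergraph C} (h : IsVertexExtension G H)
    {e : G.V → F.V} (he : IsEmb G.E F.E e) : IsVertexExtension F H :=
  let ⟨x, _, hf⟩ := h
  ⟨x, _, he.comp hf⟩

theorem exists_map_inducedVal (H : DCHypergraph C) {U : Set H.V} {l : List H.V}
    (h : ∀ v ∈ l, v ∈ U) : ∃ l' : List (H.induce U).V, l'.map (H.inducedVal U) = l :=
  exists_map_eq_of_forall_mem _ _ fun v hv => H.exists_inducedVal (h v hv)

theorem starJoin_single_subset_iff {P : Set (DCHypergraph C)} (hP : IsInducedHereditary P)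
    (G : DCHypergraph C) :
    starJoin ![G, single] ⊆ P ↔ ∀ H, IsVertexExtension G H → H ∈ P := by
  constructor
  · rintro h H ⟨x, f, hf⟩
    -- The added vertex `x` goes to `single`; every other vertex follows `f` into `G`.
    have hy : ∀ v : H.V, ∃ y : (disjointUnion ![G, single]).V,
        (v = x → y = incl ![G, single] 1 ()) ∧
        ∀ w, H.inducedVal {x}ᶜ w = v → y = incl ![G, single] 0 (f w) := by
      intro v
      by_cases hv : v = x
      · exact ⟨_, fun _ => rfl, fun w hw => absurd (hw.trans hv) (H.inducedVal_mem _ w)⟩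
      · obtain ⟨w, rfl⟩ := H.exists_inducedVal (U := {x}ᶜ) hv
        exact ⟨incl ![G, single] 0 (f w), fun h => absurd h hv, fun w' hw' => by
          rw [(H.isEmb_inducedVal _).1 hw']⟩
    choose φ hφ1 hφ0 using hy
    have hx : ∀ v, v ≠ x → ∃ w, H.inducedVal {x}ᶜ w = v := fun v hv => H.exists_inducedVal hv
    have h01 : ∀ (a : G.V) (b : Unit),
        incl ![G, single] 0 a ≠ incl ![G, single] 1 b := fun a b e => by
      have := incl_index (X := ![G, single]) e
      simp at this
    refine mem_of_starJoin_subset hP h (f := φ) ?_ ?_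
    · intro v v' e
      by_cases hv : v = x <;> by_cases hv' : v' = x
      · rw [hv, hv']
      · obtain ⟨w, hw⟩ := hx v' hv'
        rw [hφ1 v hv, hφ0 v' w hw] at e
        exact absurd e.symm (h01 _ _)
      · obtain ⟨w, hw⟩ := hx v hv
        rw [hφ1 v' hv', hφ0 v w hw] at e
        exact absurd e (h01 _ _)
      · obtain ⟨w, rfl⟩ := hx v hv
        obtain ⟨w', rfl⟩ := hx v' hv'
        rw [hφ0 _ w rfl, hφ0 _ w' rfl] at e
        rw [hf.1 (incl_injective ![G, single] 0 e)]
    · intro i l l' c e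
      have hmem : ∀ v ∈ l, ∃ u, incl ![G, single] i u = φ v := by
        intro v hv
        have : φ v ∈ l'.map (incl _ i) := by
          rw [e]
          exact List.mem_map_of_mem hv
        obtain ⟨u, _, hu⟩ := List.mem_map.1 this
        exact ⟨u, hu⟩
      induction i using Fin.cases with
      | zero =>
        obtain ⟨l₁, rfl⟩ := H.exists_map_inducedVal (U := {x}ᶜ) (l := l) fun v hv hvx => by
          obtain ⟨u, hu⟩ := hmem v hv
          rw [hφ1 v hvx] at hu
          exact h01 _ _ hu
        have e' : l'.map (incl ![G, single] 0) = (l₁.map f).map (incl ![G, single] 0) := by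
          refine e.trans (List.map_map.trans (Eq.trans ?_ List.map_map.symm))
          exact List.map_congr_left fun w _ => hφ0 _ w rfl
        rw [List.map_injective_iff.2 (incl_injective ![G, single] 0) e']
        exact hf.2 l₁ c
      | succ j =>
        obtain rfl := Subsingleton.elim j 0
        refine iff_of_false (not_mem_of_subsingleton (x := x) fun v hv => ?_)
          (not_mem_of_subsingleton (H := single) (x := ()) fun _ _ => rfl)
        by_contra hvx
        obtain ⟨w, hw⟩ := hx v hvx
        obtain ⟨u, hu⟩ := hmem v hv
        rw [hφ0 v w hw] at hu
        exact h01 _ _ hu.symm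
  · rintro h H ⟨φ, hφ⟩
    let x : H.V := φ ⟨1, ()⟩
    refine h H ⟨x, (isEmb_of_starJoin hφ 0).exists_lift (H.isEmb_inducedVal {x}ᶜ) fun v => ?_⟩
    obtain ⟨⟨i, w⟩, hw⟩ := φ.surjective (H.inducedVal _ v)
    induction i using Fin.cases with
    | zero => exact ⟨w, hw⟩
    | succ j =>
      obtain rfl := Subsingleton.elim j 0
      exact absurd hw.symm (H.inducedVal_mem {x}ᶜ v)

theorem mem_strict_iff {P : Set (DCHypergraph C)} (hP : IsInducedHereditary P)
    (G : DCHypergraph C) :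
    G ∈ strict P ↔ G ∈ P ∧ ∃ H, IsVertexExtension G H ∧ H ∉ P := by
  rw [strict, Set.mem_ofPred_eq, starJoin_single_subset_iff hP]
  push Not
  rfl

/-- A one-vertex extension of `G` outside `P` also counts as one of `F`, because vertex extensions
start from induced subhypergraphs. -/
theorem strict_of_isEmb {P : Set (DCHypergraph C)} (hP : IsInducedHereditary P)
    {G F : DCHypergraph C} (hG : G ∈ strict P) (hF : F ∈ P) {e : G.V → F.V}
    (he : IsEmb G.E F.E e) : F ∈ strict P := by
  obtain ⟨-, H, hH, hH'⟩ := (mem_strict_iff hP G).1 hG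
  exact (mem_strict_iff hP F).2 ⟨hF, H, hH.of_isEmb he, hH'⟩

theorem nonempty_of_mem_strict {P : Set (DCHypergraph C)} (hP : IsAdditiveInducedHereditary P)
    {G : DCHypergraph C} (hG : G ∈ strict P) : Nonempty G.V := by
  by_contra hne
  rw [not_nonempty_iff] at hne
  obtain ⟨-, H, ⟨x, f, -⟩, hH⟩ := (mem_strict_iff hP.isInducedHereditary G).1 hG
  refine hH (mem_of_subsingleton hP H x fun v => ?_)
  by_contra hv
  obtain ⟨w, -⟩ := H.exists_inducedVal (U := {x}ᶜ) hv
  exact isEmptyElim (f w)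

/-- Induction on the number of vertices: if `H` lies outside `P` but `H` minus a vertex lies inside,
the latter is strict. -/
theorem eq_univ_of_strict_eq_empty {P : Set (DCHypergraph C)}
    (hP : IsAdditiveInducedHereditary P) (h : strict P = ∅) : P = Set.univ := by
  have key : ∀ n (H : DCHypergraph C), Nat.card H.V = n → H ∈ P := by
    intro n
    induction n using Nat.strong_induction_on with
    | _ n ih =>
      intro H hn
      have := H.finite_V
      rcases isEmpty_or_nonempty H.V with he | ⟨⟨x⟩⟩
      · exact mem_of_isEmpty hP H
      · have hlt : Nat.card (H.induce {x}ᶜ).V < n := by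
          rw [← hn]
          exact Finite.card_subtype_lt (p := fun v => v ∈ ({x}ᶜ : Set H.V)) (x := x) (by simp)
        by_contra hH
        have : H.induce {x}ᶜ ∈ strict P :=
          (mem_strict_iff hP.isInducedHereditary _).2 ⟨ih _ hlt _ rfl, H,
            ⟨x, id, Function.injective_id, fun l c => by rw [List.map_id]⟩, hH⟩
        simp [h] at this
  exact Set.eq_univ_of_forall fun H => key _ H rfl

/-! ### Compatible colourings from decompositions -/

/-- The colouring `χ` of the vertices of a structure with edge set `E` is compatible with `P` if
every hypergraph, whose vertices come from copies of vertices in `S` and whose monochromatic parts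
are inherited from the structure, is in `P`. -/
def IsCompatible (P : Set (DCHypergraph C)) {Ω : Type*} (E : Set (List Ω × C)) (S : Set Ω)
    (χ : Ω → Bool) : Prop :=
  ∀ (H : DCHypergraph C) (f : H.V → ℕ × Ω), Function.Injective f → (∀ v, (f v).2 ∈ S) →
    (∀ b l c, (∀ v ∈ l, χ (f v).2 = b) → ((l, c) ∈ H.E ↔ (l.map f, c) ∈ copyEdges E)) → H ∈ P

/-- The first coordinates of `f` say which copy of a part each vertex comes from. Merging all parts
other than `W i₀` into one colour is harmless: it only prescribes more of the edges of `H`. -/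
theorem IsDecomposition.isCompatible {P : Set (DCHypergraph C)} (hP : IsInducedHereditary P)
    {Ω : Type*} {E : Set (List Ω × C)} (hE : ∀ c, ([], c) ∉ E) {F : DCHypergraph C}
    {e : F.V → Ω} (he : IsEmb F.E E e) {n : ℕ} {W : Fin n → Set F.V}
    (hW : IsDecomposition P F W) (i₀ : Fin n) {χ : Ω → Bool}
    (hχ : ∀ w, χ (e w) = true ↔ w ∈ W i₀) : IsCompatible P E (Set.range e) χ := by
  classical
  intro H f hf hS hmono
  have := H.finite_V
  obtain ⟨⟨hdisj, hcov⟩, -, hdec⟩ := hW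
  have hp : ∀ w, ∃ i, w ∈ W i := fun w => Set.mem_iUnion.1 (hcov ▸ Set.mem_univ w)
  choose p hp using hp
  choose w hw using hS
  obtain ⟨k, hk⟩ : ∃ k, ∀ v, (f v).1 < k := by
    obtain ⟨k, hk⟩ := (Set.finite_range fun v => (f v).1).bddAbove
    exact ⟨k + 1, fun v => Nat.lt_succ_of_le (hk ⟨v, rfl⟩)⟩
  -- Below, `k + 1` copies are used, so that the number of copies is visibly positive.
  let Y : Fin n → DCHypergraph C := fun i => F.induce (W i)
  let X : Fin n → DCHypergraph C := fun i => copies (k + 1) (Y i)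
  have hu : ∀ v, ∃ u : (Y (p (w v))).V, F.inducedVal _ u = w v := fun v =>
    F.exists_inducedVal (hp _)
  choose u hu using hu
  let φ : H.V → (disjointUnion X).V := fun v =>
    incl X (p (w v)) (incl (fun _ : Fin (k + 1) => Y (p (w v)))
      ⟨(f v).1, (hk v).trans k.lt_succ_self⟩ (u v))
  let ρ : ∀ i, (X i).V → ℕ × Ω := fun i =>
    glue (X := fun _ : Fin (k + 1) => Y i) fun a z => ((a : ℕ), (e ∘ F.inducedVal (W i)) z)
  have hρ : ∀ i, IsEmb (X i).E (copyEdges E) (ρ i) := fun i =>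
    isEmb_disjointUnion hE (fun _ : Fin (k + 1) => Y i) Fin.val_injective
      fun _ => he.comp (F.isEmb_inducedVal _)
  have hφ : ∀ v, glue ρ (φ v) = f v := fun v => by
    change ((f v).1, e (F.inducedVal _ (u v))) = f v
    rw [hu, hw]
  refine mem_of_starJoin_subset hP (hdec (k + 1) k.succ_pos) (f := φ) ?_ ?_
  · intro v v' h
    exact hf (by rw [← hφ, ← hφ, h])
  · intro i l l' c h
    have hi : ∀ v ∈ l, p (w v) = i := by
      intro v hv
      have : φ v ∈ l'.map (incl X i) := by
        rw [h]
        exact List.mem_map_of_mem hv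
      obtain ⟨_, _, h⟩ := List.mem_map.1 this
      exact (incl_index h).symm
    -- A list inside part `i` is monochromatic, of colour true exactly when `i = i₀`.
    rw [hmono (decide (i = i₀)) l c, (hρ i).2]
    · have : l.map f = l'.map (ρ i) := by
        calc l.map f = (l.map φ).map (glue ρ) := by
              rw [List.map_map]
              exact List.map_congr_left fun v _ => (hφ v).symm
          _ = l'.map (ρ i) := by
              rw [← h, List.map_map, glue_comp_incl]
      rw [this]
    · intro v hv
      rw [← hw, Bool.eq_iff_iff, hχ, decide_eq_true_iff]
      constructor
      · intro h
        by_contra hne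
        exact (hdisj i i₀ hne).le_bot ⟨hi v hv ▸ hp (w v), h⟩
      · rintro rfl
        exact hi v hv ▸ hp (w v)

/-! ### Lower bounds on the decomposition number -/

/-- The one-part partition is a decomposition by additivity; it is non-empty since strict
hypergraphs have a vertex. -/
theorem one_le_decNumber {P : Set (DCHypergraph C)} (hP : IsAdditiveInducedHereditary P)
    {G : DCHypergraph C} (hG : G ∈ strict P) : 1 ≤ decNumber P G := by
  refine le_sSup ⟨1, by simp, hG.1, fun _ => Set.univ, ⟨?_, ?_⟩, ?_, ?_⟩
  · exact fun i j h => absurd (Subsingleton.elim i j) h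
  · exact Set.iUnion_const _
  · have := nonempty_of_mem_strict hP hG
    exact fun _ => Set.univ_nonempty
  · rintro k - H ⟨φ, hφ⟩
    have hk : copies k (G.induce Set.univ) ∈ P := disjointUnion_mem hP _ fun _ =>
      hP.isInducedHereditary.mem_of_isEmb (G.isEmb_inducedVal _) hG.1
    have hs : ∀ v, ∃ z, φ ⟨0, z⟩ = v := by
      intro v
      obtain ⟨⟨i, z⟩, hz⟩ := φ.surjective v
      obtain rfl := Subsingleton.elim i 0
      exact ⟨z, hz⟩
    have hid : IsEmb H.E H.E id :=
      ⟨Function.injective_id, fun l c => by rw [List.map_id]⟩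
    obtain ⟨f, hf⟩ := (isEmb_of_starJoin hφ 0).exists_lift hid hs
    exact hP.isInducedHereditary.mem_of_isEmb hf hk

theorem IsReducible.two_le_dec {P : Set (DCHypergraph C)} (hP : IsAdditiveInducedHereditary P)
    (h : IsReducible P) : 2 ≤ dec P := by
  obtain ⟨P₁, P₂, h₁, h₂, rfl⟩ := h
  have hQ : ∀ i : Fin 2, IsAdditiveInducedHereditary (![P₁, P₂] i) :=
    Fin.forall_fin_two.2 ⟨h₁, h₂⟩
  generalize ![P₁, P₂] = Q at *
  refine le_iInf₂ fun G hG => ?_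
  obtain ⟨W, hW, hWQ⟩ := hG.1
  refine le_sSup ⟨2, by simp, hG.1, W, hW, fun i => ?_, ?_⟩
  · rw [Set.nonempty_iff_ne_empty]
    intro hi
    obtain ⟨-, H, ⟨x, f, hf⟩, hH⟩ := (mem_strict_iff hP.isInducedHereditary G).1 hG
    -- With part `i` empty, `G` lies wholly in the other factor. The added vertex alone takes part
    -- `i`, so the extension is in the product.
    refine hH ⟨fun j => if j = i then {x} else {x}ᶜ, ⟨?_, ?_⟩, ?_⟩
    · intro j k hjk
      by_cases hj : j = i <;> by_cases hk : k = i
      · exact absurd (hj.trans hk.symm) hjk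
      · simp [hj, hk]
      · simp [hj, hk]
      · omega
    · rw [Set.eq_univ_iff_forall]
      intro v
      rw [Set.mem_iUnion]
      by_cases hv : v = x
      · exact ⟨i, by simp [hv]⟩
      · refine ⟨i + 1, ?_⟩
        have : i + 1 ≠ i := by omega
        simp [this, hv]
    · intro j
      by_cases hj : j = i
      · have hU : (if j = i then {x} else {x}ᶜ : Set H.V) = {x} := if_pos hj
        refine mem_of_subsingleton (hQ j) _ ⟨x, hU.ge rfl⟩ fun v => Subtype.ext (hU.le v.2)
      · have hU : (if j = i then {x} else {x}ᶜ : Set H.V) = {x}ᶜ := if_neg hj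
        have hG' : ∀ v, ∃ w, G.inducedVal (W j) w = v := fun v => by
          obtain ⟨k, hk⟩ := Set.mem_iUnion.1 (hW.2.ge (Set.mem_univ v))
          have hki : k ≠ i := by
            rintro rfl
            simp [hi] at hk
          obtain rfl : k = j := by omega
          exact G.exists_inducedVal hk
        obtain ⟨g, hg⟩ := (G.isEmb_inducedVal (W j)).exists_lift hf fun _ => hG' _
        have := (hQ j).isInducedHereditary.mem_of_isEmb hg (hWQ j)
        rw [← hU] at this
        exact this
  · rintro k - H ⟨φ, hφ⟩
    let X : Fin 2 → DCHypergraph C := fun i => copies k (G.induce (W i))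
    have hk : ∀ i, X i ∈ Q i := fun i => disjointUnion_mem (hQ i) _ fun _ => hWQ i
    refine ⟨fun i => Set.range fun z : (X i).V => φ ⟨i, z⟩, ⟨?_, ?_⟩, fun i => ?_⟩
    · intro i j hij
      rw [Set.disjoint_iff_forall_ne]
      rintro _ ⟨z, rfl⟩ _ ⟨z', rfl⟩ e
      exact hij (congrArg Sigma.fst (φ.injective e))
    · rw [Set.eq_univ_iff_forall]
      intro v
      obtain ⟨⟨i, z⟩, rfl⟩ := φ.surjective v
      exact Set.mem_iUnion.2 ⟨i, z, rfl⟩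
    · obtain ⟨f, hf⟩ := (isEmb_of_starJoin (X := X) hφ i).exists_lift (H.isEmb_inducedVal _)
        fun v => H.inducedVal_mem (Set.range fun z : (X i).V => φ ⟨i, z⟩) v
      exact (hQ i).isInducedHereditary.mem_of_isEmb hf (hk i)

/-! ### The disjoint union of all members of the property -/

/-- The inclusion of the vertices of `G` in those of the disjoint union of all the hypergraphs
in `P`. -/
abbrev vtx {P : Set (DCHypergraph C)} (G : P) : G.1.V → Σ G : P, G.1.V := fun v => ⟨G, v⟩

theorem vtx_injective {P : Set (DCHypergraph C)} (G : P) : Function.Injective (vtx G) :=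
  fun _ _ h => eq_of_heq (Sigma.mk.inj h).2

/-- The edges of the disjoint union of all the hypergraphs in `P`. -/
def allEdges (P : Set (DCHypergraph C)) : Set (List (Σ G : P, G.1.V) × C) :=
  {e | ∃ (G : P) (l : List G.1.V), (l, e.2) ∈ G.1.E ∧ l.map (vtx G) = e.1}

theorem nil_not_mem_allEdges (P : Set (DCHypergraph C)) (c : C) : ([], c) ∉ allEdges P := by
  rintro ⟨G, l, h, e⟩
  obtain rfl : l = [] := by simpa using e
  exact nil_not_mem _ _ h

theorem not_mem_allEdges_of_subsingleton {P : Set (DCHypergraph C)}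
    {l : List (Σ G : P, G.1.V)} {c : C} {x : Σ G : P, G.1.V} (h : ∀ v ∈ l, v = x) :
    (l, c) ∉ allEdges P := by
  rintro ⟨G, l', hl', rfl⟩
  cases l' with
  | nil => exact nil_not_mem _ _ hl'
  | cons y l' =>
    refine not_mem_of_subsingleton (x := y) (fun v hv => ?_) hl'
    have hv' := h ⟨G, v⟩ (List.mem_map_of_mem hv)
    have hy' := h ⟨G, y⟩ (List.mem_map_of_mem (by simp))
    exact vtx_injective G (hv'.trans hy'.symm)

theorem isEmb_allEdges {P : Set (DCHypergraph C)} (G : P) :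
    IsEmb G.1.E (allEdges P) (vtx G) := by
  refine ⟨vtx_injective _, fun l c => ⟨fun h => ⟨G, l, h, rfl⟩, ?_⟩⟩
  rintro ⟨G', l', h, e⟩
  cases l' with
  | nil => exact absurd h (nil_not_mem _ _)
  | cons v l' =>
    cases l with
    | nil => simp at e
    | cons w l =>
      obtain rfl : G' = G := by
        simp only [List.map_cons, List.cons.injEq] at e
        exact congrArg Sigma.fst e.1
      rwa [← List.map_injective_iff.2 (vtx_injective _) e]

theorem isEmb_disjointUnion_allEdges {P : Set (DCHypergraph C)} {n : ℕ} {g : Fin n → P}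
    (hg : Function.Injective g) :
    IsEmb (disjointUnion fun i => (g i).1).E (allEdges P)
      (glue fun i v => (⟨g i, v⟩ : Σ G : P, G.1.V)) := by
  constructor
  · intro x y h
    obtain ⟨i, v, rfl⟩ := exists_incl x
    obtain ⟨j, w, rfl⟩ := exists_incl y
    have h' : (⟨g i, v⟩ : Σ G : P, G.1.V) = ⟨g j, w⟩ := h
    obtain rfl := hg (congrArg Sigma.fst h')
    exact congrArg _ (vtx_injective _ h')
  · intro l c
    constructor
    · intro h
      obtain ⟨i, l', h', rfl⟩ := mem_disjointUnion_E.1 h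
      refine ⟨g i, l', h', ?_⟩
      rw [List.map_map]
      rfl
    · rintro ⟨G, l', h, e⟩
      simp only at h e
      have key : ∀ i v, incl _ i v ∈ l → g i = G := by
        intro i v hv
        have : (⟨g i, v⟩ : Σ G : P, G.1.V) ∈ l'.map (vtx G) := by
          rw [e]
          exact List.mem_map_of_mem
            (f := glue fun i v => (⟨g i, v⟩ : Σ G : P, G.1.V)) hv
        obtain ⟨_, _, h⟩ := List.mem_map.1 this
        exact (congrArg Sigma.fst h).symm
      cases l with
      | nil =>
        obtain rfl : l' = [] := by simpa using e
        exact absurd h (nil_not_mem _ _)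
      | cons x l =>
        obtain ⟨i, v, rfl⟩ := exists_incl x
        obtain rfl := key i v (by simp)
        obtain ⟨l₁, hl₁⟩ := exists_map_incl (i := i) fun j w hw =>
          hg (key j w hw)
        rw [← hl₁] at e ⊢
        rw [List.map_map, glue_comp_incl] at e
        rw [← List.map_injective_iff.2 (vtx_injective _) e]
        exact map_incl_mem.2 h

/-! ### Two-colourings and compactness -/

/-- If `G` avoids the colour of `x`, then in any one-vertex extension of `G` the new vertex can be
sent to `x`. Edges through it are never monochromatic, so compatibility puts all these extensions in
`P`, against strictness. -/
theorem IsCompatible.exists_color {P : Set (DCHypergraph C)} (hP : IsInducedHereditary P)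
    {S : Set (Σ G : P, G.1.V)} {χ : (Σ G : P, G.1.V) → Bool}
    (h : IsCompatible P (allEdges P) S χ) {G : P} (hG : G.1 ∈ strict P)
    (hS : ∀ v, (⟨G, v⟩ : Σ G : P, G.1.V) ∈ S) {x : Σ G : P, G.1.V} (hx : x ∈ S) :
    ∃ v, χ ⟨G, v⟩ = χ x := by
  by_contra! hne
  obtain ⟨-, H, ⟨y, f, hf⟩, hH⟩ := (mem_strict_iff hP G).1 hG
  have hz : ∀ v : H.V, ∃ z : Σ G : P, G.1.V, (v = y → z = x) ∧
      ∀ w, H.inducedVal {y}ᶜ w = v → z = ⟨G, f w⟩ := by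
    intro v
    by_cases hv : v = y
    · exact ⟨x, fun _ => rfl, fun w hw => absurd (hw.trans hv) (H.inducedVal_mem _ w)⟩
    · obtain ⟨w, rfl⟩ := H.exists_inducedVal (U := {y}ᶜ) hv
      exact ⟨⟨G, f w⟩, fun h => absurd h hv, fun w' hw' => by
        rw [(H.isEmb_inducedVal _).1 hw']⟩
  choose φ hφ1 hφ0 using hz
  have hy : ∀ v, v ≠ y → ∃ w, H.inducedVal {y}ᶜ w = v := fun v hv => H.exists_inducedVal hv
  refine hH (h H (fun v => (0, φ v)) ?_ ?_ ?_)
  · intro v v' e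
    have e : φ v = φ v' := (Prod.mk.inj e).2
    by_cases hv : v = y <;> by_cases hv' : v' = y
    · rw [hv, hv']
    · obtain ⟨w, hw⟩ := hy v' hv'
      rw [hφ1 v hv, hφ0 v' w hw] at e
      exact absurd (congrArg χ e.symm) (hne _)
    · obtain ⟨w, hw⟩ := hy v hv
      rw [hφ1 v' hv', hφ0 v w hw] at e
      exact absurd (congrArg χ e) (hne _)
    · obtain ⟨w, rfl⟩ := hy v hv
      obtain ⟨w', rfl⟩ := hy v' hv'
      rw [hφ0 _ w rfl, hφ0 _ w' rfl] at e
      rw [hf.1 (vtx_injective _ e)]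
  · intro v
    by_cases hv : v = y
    · exact (hφ1 v hv).symm ▸ hx
    · obtain ⟨w, hw⟩ := hy v hv
      exact (hφ0 v w hw).symm ▸ hS _
  · intro b l c hb
    have hl : l.map (fun v => ((0 : ℕ), φ v)) = (l.map φ).map (Prod.mk 0) := by
      rw [List.map_map]
      rfl
    rw [hl, ← (isEmb_copyEdges (allEdges P) 0).2]
    -- A list of the colour of `x` contains only `y` and supports no edge; a list of the other
    -- colour avoids `y` and is governed by `G`.
    by_cases hbx : χ x = b
    · have hly : ∀ v ∈ l, v = y := by
        intro v hv
        by_contra hvy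
        obtain ⟨w, hw⟩ := hy v hvy
        have := hb v hv
        rw [hφ0 v w hw, ← hbx] at this
        exact hne _ this
      refine iff_of_false (not_mem_of_subsingleton hly)
        (not_mem_allEdges_of_subsingleton (x := x) fun v hv => ?_)
      obtain ⟨u, hu, rfl⟩ := List.mem_map.1 hv
      exact hφ1 u (hly u hu)
    · obtain ⟨l₁, rfl⟩ := H.exists_map_inducedVal (U := {y}ᶜ) (l := l) fun v hv hvy => by
        have := hb v hv
        rw [hφ1 v hvy] at this
        exact hbx this
      rw [← (H.isEmb_inducedVal {y}ᶜ).2, hf.2, (isEmb_allEdges G).2, List.map_map, List.map_map]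
      have : φ ∘ H.inducedVal {y}ᶜ = vtx G ∘ f := funext fun w => hφ0 _ w rfl
      rw [this]

theorem exists_isCompatible_finset {P : Set (DCHypergraph C)}
    (hP : IsAdditiveInducedHereditary P) (hdec : ∀ G ∈ strict P, 1 < decNumber P G) {G₀ : P}
    (hG₀ : G₀.1 ∈ strict P) (s : Finset P) (hs : G₀ ∈ s) :
    ∃ χ : (Σ G : P, G.1.V) → Bool, IsCompatible P (allEdges P) {x | x.1 ∈ s} χ ∧
      ∀ b, ∃ v, χ ⟨G₀, v⟩ = b := by
  classical
  let g : Fin s.card → P := fun i => (s.equivFin.symm i).1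
  have hg : Function.Injective g := Subtype.val_injective.comp s.equivFin.symm.injective
  have hgs : ∀ G ∈ s, ∃ i, g i = G := fun G hG => ⟨s.equivFin ⟨G, hG⟩, by simp [g]⟩
  let F : DCHypergraph C := disjointUnion fun i => (g i).1
  let e : F.V → Σ G : P, G.1.V := glue fun i v => (⟨g i, v⟩ : Σ G : P, G.1.V)
  have he : IsEmb F.E (allEdges P) e := isEmb_disjointUnion_allEdges hg
  have hFP : F ∈ P := disjointUnion_mem hP _ fun i => (g i).2
  have hr : Set.range e = {x | x.1 ∈ s} := by
    ext x
    constructor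
    · rintro ⟨y, rfl⟩
      exact (s.equivFin.symm y.1).2
    · intro hx
      obtain ⟨G, v⟩ := x
      obtain ⟨i, rfl⟩ := hgs G hx
      exact ⟨incl _ i v, rfl⟩
  have hF : F ∈ strict P := by
    have h0 : ∀ v, ∃ y, e y = (⟨G₀, v⟩ : Σ G : P, G.1.V) := fun v => hr.ge hs
    obtain ⟨f, hf⟩ := he.exists_lift (isEmb_allEdges G₀) h0
    exact strict_of_isEmb hP.isInducedHereditary hG₀ hFP hf
  obtain ⟨m, ⟨n, rfl, -, W, hW⟩, hn⟩ := lt_sSup_iff.1 (hdec F hF)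
  have hn : 1 < n := by exact_mod_cast hn
  let i₀ : Fin n := ⟨0, by omega⟩
  let i₁ : Fin n := ⟨1, hn⟩
  -- The default `false` off the range of `e` is immaterial, as compatibility is only claimed over
  -- `s`.
  let χ : (Σ G : P, G.1.V) → Bool :=
    Function.extend e (fun w => decide (w ∈ W i₀)) fun _ => false
  have hχ : ∀ w, χ (e w) = decide (w ∈ W i₀) := fun w => he.1.extend_apply _ _ w
  have hc : IsCompatible P (allEdges P) {x | x.1 ∈ s} χ :=
    hr ▸ hW.isCompatible hP.isInducedHereditary (nil_not_mem_allEdges P) he i₀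
      fun w => by rw [hχ, decide_eq_true_iff]
  refine ⟨χ, hc, fun b => ?_⟩
  have hb : ∃ w, χ (e w) = b := by
    obtain ⟨w₀, hw₀⟩ := hW.2.1 i₀
    obtain ⟨w₁, hw₁⟩ := hW.2.1 i₁
    cases b with
    | true => exact ⟨w₀, (hχ w₀).trans (decide_eq_true hw₀)⟩
    | false =>
      refine ⟨w₁, (hχ w₁).trans (decide_eq_false fun h => ?_)⟩
      exact (hW.1.1 i₀ i₁ (by simp [i₀, i₁])).le_bot ⟨h, hw₁⟩
  obtain ⟨w, rfl⟩ := hb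
  -- Both colours occur somewhere in `F`; strictness of `G₀` brings them to the fixed finite set of
  -- its vertices.
  exact hc.exists_color hP.isInducedHereditary hG₀ (fun _ => hs) (hr.le ⟨w, rfl⟩)

/-- Compactness: each test hypergraph `H`, and `G₀` itself, has finitely many vertices, so on them
the limit agrees with a single finite-stage colouring. -/
theorem exists_isCompatible_univ {P : Set (DCHypergraph C)}
    (hP : IsAdditiveInducedHereditary P) (hdec : ∀ G ∈ strict P, 1 < decNumber P G) {G₀ : P}
    (hG₀ : G₀.1 ∈ strict P) :
    ∃ χ : (Σ G : P, G.1.V) → Bool, IsCompatible P (allEdges P) Set.univ χ ∧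
      ∀ b, ∃ v, χ ⟨G₀, v⟩ = b := by
  classical
  have h : ∀ s : Finset P, ∃ χ : (Σ G : P, G.1.V) → Bool,
      IsCompatible P (allEdges P) {x | x.1 ∈ insert G₀ s} χ ∧ ∀ b, ∃ v, χ ⟨G₀, v⟩ = b :=
    fun s => exists_isCompatible_finset hP hdec hG₀ _ (Finset.mem_insert_self _ _)
  choose χs hχs hcol using h
  -- Refining `atTop` ensures that any given member of `P` eventually belongs to `s`.
  let 𝒰 : Ultrafilter (Finset P) := Ultrafilter.of Filter.atTop
  have hlim : ∀ x, ∃ b, ∀ᶠ s in (𝒰 : Filter (Finset P)), χs s x = b := by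
    intro x
    obtain ⟨b, hb⟩ := (𝒰.map fun s => χs s x).eq_pure_of_finite
    refine ⟨b, ?_⟩
    have : {b} ∈ 𝒰.map fun s => χs s x := by rw [hb]; exact Set.mem_singleton b
    exact this
  choose χ hχ using hlim
  refine ⟨χ, fun H f hf _ hmono => ?_, fun b => ?_⟩
  · have := H.finite_V
    have h1 : ∀ᶠ s in (𝒰 : Filter (Finset P)), ∀ v, χs s (f v).2 = χ (f v).2 :=
      Filter.eventually_all.2 fun v => hχ _
    have h2 : ∀ᶠ s in (𝒰 : Filter (Finset P)), ∀ v, (f v).2.1 ∈ s :=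
      Filter.eventually_all.2 fun v => Ultrafilter.of_le _
        ((Filter.eventually_ge_atTop {(f v).2.1}).mono fun s hs => hs (Finset.mem_singleton_self _))
    obtain ⟨s, hs1, hs2⟩ := (h1.and h2).exists
    refine hχs s H f hf (fun v => Finset.mem_insert_of_mem (hs2 v)) fun b l c hb => ?_
    exact hmono b l c fun v hv => hs1 v ▸ hb v hv
  · have := G₀.1.finite_V
    obtain ⟨s, hs⟩ := (Filter.eventually_all.2 fun v => hχ ⟨G₀, v⟩).exists
    obtain ⟨v, hv⟩ := hcol s b
    exact ⟨v, (hs v).symm.trans hv⟩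

/-! ### Colour classes as factors -/

/-- The hypergraphs that embed into copies of the part of colour `b` of the disjoint union of all
the hypergraphs in `P`. -/
def colorClass (P : Set (DCHypergraph C)) (χ : (Σ G : P, G.1.V) → Bool) (b : Bool) :
    Set (DCHypergraph C) :=
  {X | ∃ f : X.V → ℕ × Σ G : P, G.1.V,
    IsEmb X.E (copyEdges (allEdges P)) f ∧ ∀ v, χ (f v).2 = b}

theorem induce_mem_colorClass {P : Set (DCHypergraph C)} (χ : (Σ G : P, G.1.V) → Bool) (b : Bool)
    (G : P) : G.1.induce {v | χ ⟨G, v⟩ = b} ∈ colorClass P χ b :=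
  ⟨_, (isEmb_copyEdges _ 0).comp ((isEmb_allEdges G).comp (G.1.isEmb_inducedVal _)),
    fun v => G.1.inducedVal_mem {v | χ ⟨G, v⟩ = b} v⟩

theorem isAdditiveInducedHereditary_colorClass {P : Set (DCHypergraph C)}
    (χ : (Σ G : P, G.1.V) → Bool) (b : Bool) (h : ∃ x, χ x = b) :
    IsAdditiveInducedHereditary (colorClass P χ b) where
  isProperty :=
    { iso_closed := by
        rintro G H ⟨e⟩ ⟨f, hf, hb⟩
        have hs : ∀ v, ∃ w, e.toEquiv w = v := e.toEquiv.surjective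
        obtain ⟨g, hg⟩ := e.isEmb.exists_lift (k := id)
          ⟨Function.injective_id, fun l c => by rw [List.map_id]⟩ hs
        exact ⟨_, hf.comp hg, fun v => hb _⟩
      exists_nonnull := by
        obtain ⟨⟨G, v⟩, hv⟩ := h
        exact ⟨_, induce_mem_colorClass χ b G, ⟨v, hv⟩⟩ }
  isInducedHereditary := isInducedHereditary_iff.2 fun _ _ _ hg ⟨_, hf, hb⟩ =>
    ⟨_, hf.comp hg, fun _ => hb _⟩
  isAdditive := by
    intro G H hG hH
    have hX : ∀ i, (![G, H] : Fin 2 → DCHypergraph C) i ∈ colorClass P χ b :=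
      Fin.forall_fin_two.2 ⟨hG, hH⟩
    choose f hf hb using hX
    refine ⟨_, (isEmb_copyEdges_copyEdges _).comp (isEmb_disjointUnion
      (not_mem_copyEdges (nil_not_mem_allEdges P)) _ Fin.val_injective hf), fun x => ?_⟩
    obtain ⟨i, v, rfl⟩ := exists_incl x
    exact hb i v

/-- A member `H` of `P` is split by the colours of its own copy in the big union. Conversely,
embeddings of the two parts combine into a map to which compatibility applies. -/
theorem IsCompatible.eq_product {P : Set (DCHypergraph C)} {χ : (Σ G : P, G.1.V) → Bool}
    (h : IsCompatible P (allEdges P) Set.univ χ) :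
    P = product ![colorClass P χ true, colorClass P χ false] := by
  ext H
  constructor
  · intro hH
    refine ⟨![{v | χ ⟨⟨H, hH⟩, v⟩ = true}, {v | χ ⟨⟨H, hH⟩, v⟩ = false}], ⟨?_, ?_⟩, ?_⟩
    · have hd : Disjoint {v | χ ⟨⟨H, hH⟩, v⟩ = true} {v | χ ⟨⟨H, hH⟩, v⟩ = false} := by
        rw [Set.disjoint_left]
        intro v hv hv'
        exact Bool.false_ne_true (hv'.symm.trans hv)
      intro i j hij
      fin_cases i <;> fin_cases j
      · exact absurd rfl hij
      · exact hd
      · exact hd.symm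
      · exact absurd rfl hij
    · rw [Set.eq_univ_iff_forall]
      intro v
      rw [Set.mem_iUnion]
      cases hv : χ ⟨⟨H, hH⟩, v⟩ with
      | true => exact ⟨0, hv⟩
      | false => exact ⟨1, hv⟩
    · exact Fin.forall_fin_two.2
        ⟨induce_mem_colorClass χ true ⟨H, hH⟩, induce_mem_colorClass χ false ⟨H, hH⟩⟩
  · rintro ⟨W, ⟨-, hcov⟩, hW⟩
    have hW' : ∀ i : Fin 2, H.induce (W i) ∈ colorClass P χ (![true, false] i) :=
      Fin.forall_fin_two.2 ⟨hW 0, hW 1⟩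
    choose f hf hb using hW'
    have hp : ∀ v, ∃ i, ∃ w, H.inducedVal (W i) w = v := fun v =>
      let ⟨i, hi⟩ := Set.mem_iUnion.1 (hcov.ge (Set.mem_univ v))
      ⟨i, H.exists_inducedVal hi⟩
    choose p w hw using hp
    have hbp : ∀ v v', χ (f _ (w v)).2 = χ (f _ (w v')).2 → p v = p v' := by
      intro v v' e
      rw [hb, hb] at e
      exact (show Function.Injective (![true, false] : Fin 2 → Bool) by decide) e
    -- The type of `w v` depends on `p v`; lifting a whole list at once, with `i` fixed, avoids
    -- transport between parts.
    have hlift : ∀ (i : Fin 2) (l : List H.V), (∀ v ∈ l, p v = i) →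
        ∃ l₁ : List (H.induce (W i)).V, l₁.map (H.inducedVal (W i)) = l ∧
          l.map (fun v => f _ (w v)) = l₁.map (f i) := by
      intro i l hl
      induction l with
      | nil => exact ⟨[], rfl, rfl⟩
      | cons v l ih =>
        obtain ⟨l₁, h1, h2⟩ := ih fun u hu => hl u (List.mem_cons_of_mem _ hu)
        obtain rfl := hl v (by simp)
        exact ⟨w v :: l₁, by rw [List.map_cons, hw, h1], by rw [List.map_cons, h2, List.map_cons]⟩
    refine h H (fun v => f _ (w v)) ?_ (fun _ => Set.mem_univ _) ?_
    · intro v v' e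
      have hpp := hbp v v' (congrArg (fun z => χ z.2) e)
      obtain ⟨l₁, h1, h2⟩ := hlift (p v) [v] (by simp)
      obtain ⟨l₂, h3, h4⟩ := hlift (p v) [v'] (by simp [hpp])
      have e' : [v].map (fun v => f _ (w v)) = [v'].map (fun v => f _ (w v)) := by
        simpa using e
      rw [h2, h4] at e'
      have := List.map_injective_iff.2 (hf (p v)).1 e'
      rw [this, h3] at h1
      exact (List.singleton_injective h1).symm
    · intro b l c hl
      have hi : ∃ i, ∀ v ∈ l, p v = i := by
        cases l with
        | nil => exact ⟨0, by simp⟩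
        | cons v l =>
          exact ⟨p v, fun u hu => hbp u v ((hl u hu).trans (hl v (by simp)).symm)⟩
      obtain ⟨i, hi⟩ := hi
      obtain ⟨l₁, rfl, h2⟩ := hlift i l hi
      rw [h2, ← (hf i).2, ← (H.isEmb_inducedVal (W i)).2]

theorem isReducible_of_one_lt_decNumber {P : Set (DCHypergraph C)}
    (hP : IsAdditiveInducedHereditary P) (hdec : ∀ G ∈ strict P, 1 < decNumber P G) :
    IsReducible P := by
  rcases (strict P).eq_empty_or_nonempty with h | ⟨G₀, hG₀⟩
  -- Here `P` contains every hypergraph, so any partition serves, even one with an empty part.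
  · refine ⟨P, P, hP, hP, ?_⟩
    have hu := eq_univ_of_strict_eq_empty hP h
    refine (hu.trans (Set.eq_univ_of_forall fun G => ?_).symm)
    refine ⟨![Set.univ, ∅], ⟨?_, ?_⟩, Fin.forall_fin_two.2 ⟨?_, ?_⟩⟩
    · intro i j hij
      fin_cases i <;> fin_cases j <;> simp at hij ⊢
    · exact Set.eq_univ_of_forall fun v => Set.mem_iUnion.2 ⟨0, Set.mem_univ v⟩
    · exact hu.ge (Set.mem_univ _)
    · exact hu.ge (Set.mem_univ _)
  · obtain ⟨χ, hχ, hcol⟩ := exists_isCompatible_univ hP hdec (G₀ := ⟨G₀, hG₀.1⟩) hG₀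
    have hb : ∀ b, ∃ x, χ x = b := fun b => let ⟨v, hv⟩ := hcol b; ⟨_, hv⟩
    exact ⟨_, _, isAdditiveInducedHereditary_colorClass χ true (hb true),
      isAdditiveInducedHereditary_colorClass χ false (hb false), hχ.eq_product⟩

end DCHypergraph

theorem mainTheorem7 {C : Type*} (P : Set (DCHypergraph C))
    (hP : DCHypergraph.IsAdditiveInducedHereditary P) :
    DCHypergraph.IsIrreducible P ↔ DCHypergraph.IsIndecomposable P := by
  constructor
  · intro h
    refine le_antisymm ?_ (le_iInf₂ fun G hG => DCHypergraph.one_le_decNumber hP hG)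
    by_contra! hlt
    exact h (DCHypergraph.isReducible_of_one_lt_decNumber hP fun G hG =>
      hlt.trans_le (iInf₂_le G hG))
  · intro h hred
    have h2 := hred.two_le_dec hP
    rw [show DCHypergraph.dec P = 1 from h] at h2
    exact absurd h2 (by decide)
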